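/- For $d\ge 1$ let $\Psi=(\psi_{jk})_{j,k=1}^d$ be a random matrix distributed according to the Haar probability measure on the unitary group $\mathbb U(d)$, and for $k,l,m,n\in\{1,\dots,d\}$ let \[ \gamma(k,l,m,n):=\sum_{j=1}^d\overline{\psi_{jk}}\,\psi_{jl}\,\overline{\psi_{jm}}\,\psi_{jn}-\frac1d\,\delta_{kl}\delta_{mn}-\frac1d\,\delta_{kn}\delta_{lm}. \] There exist real numbers $\sigma^2_{k,l,m,n}>0$, indexed by integers $k,l,m,n\ge1$ and independent of $d$, with $\sigma^2_{k,l,m,n}=1$ whenever $k,l,m,n$ are pairwise distinct, such that for all $d\ge1$ and all $k,l,m,n,k',l',m',n'\in\{1,\dots,d\}$, \[ \mathbb E\bigl[\gamma(k,l,m,n)\,\gamma(k',l',m',n')\bigr]= \begin{cases} \sigma^2_{k,l,m,n}\,d^{-3}+O(d^{-4}) & \text{if }\gamma(k',l',m',n')=\overline{\gamma(k,l,m,n)},\\ O(d^{-4}) & \text{otherwise,} \end{cases} \] where the condition is an equality of functions of $\Psi\in\mathbb U(d)$, and the implicit constants are absolute (independent of $d$ and of all the indices). -/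

import Mathlib

namespace RandomUnitary

/-- The unitary group `U(d)` of `d × d` complex matrices. -/
abbrev U (d : ℕ) : Type := Matrix.unitaryGroup (Fin d) ℂ

theorem isCompact_unitaryGroup (d : ℕ) :
    IsCompact (Matrix.unitaryGroup (Fin d) ℂ : Set (Matrix (Fin d) (Fin d) ℂ)) := by
  have hK : IsCompact (Set.univ.pi fun _ : Fin d => Set.univ.pi fun _ : Fin d =>
      Metric.closedBall (0 : ℂ) 1) :=
    isCompact_univ_pi fun _ => isCompact_univ_pi fun _ => isCompact_closedBall _ _
  refine IsCompact.of_isClosed_subset hK isClosed_unitary ?_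
  intro A hA i _ j _
  simpa using entry_norm_bound_of_unitary hA i j

instance instCompactSpaceU (d : ℕ) : CompactSpace (U d) :=
  isCompact_iff_compactSpace.mp (isCompact_unitaryGroup d)

/-- `U(d)` carries its Borel σ-algebra. -/
noncomputable instance instMeasurableSpaceU (d : ℕ) : MeasurableSpace (U d) := borel (U d)

instance instBorelSpaceU (d : ℕ) : BorelSpace (U d) := ⟨rfl⟩

/-- The Haar probability measure on `U(d)`: the Haar measure that gives the whole (compact)
group mass one. -/
noncomputable def haarU (d : ℕ) : MeasureTheory.Measure (U d) :=
  MeasureTheory.Measure.haarMeasure ⊤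

instance instIsProbabilityMeasureHaarU (d : ℕ) :
    MeasureTheory.IsProbabilityMeasure (haarU d) :=
  ⟨by simpa [haarU] using
    MeasureTheory.Measure.haarMeasure_self (K₀ := (⊤ : TopologicalSpace.PositiveCompacts (U d)))⟩

/-- `γ(k,l,m,n) = ∑ⱼ conj ψⱼₖ ψⱼₗ conj ψⱼₘ ψⱼₙ - (1/d) δₖₗ δₘₙ - (1/d) δₖₙ δₗₘ`,
as a function of the unitary matrix `Ψ = (ψⱼₖ)`. -/
noncomputable def gamma {d : ℕ} (k l m n : Fin d) (Ψ : U d) : ℂ :=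
  (∑ j : Fin d, star (Ψ.1 j k) * Ψ.1 j l * star (Ψ.1 j m) * Ψ.1 j n)
    - (if k = l ∧ m = n then 1 / (d : ℂ) else 0)
    - (if k = n ∧ l = m then 1 / (d : ℂ) else 0)

end RandomUnitary

/-! ### Haar moments and their unitary invariance. -/

namespace RandomUnitary

open MeasureTheory Matrix Finset

/-! Haar invariance makes every mixed moment of entries, as a function of its column indices, a
tensor fixed by the unitary group. An elementary first fundamental theorem
(`IsUnitaryInvariant.eq_sum_perm`) writes such a tensor as a combination of index permutations,
provided `d` is at least the order.

For the product of two quartic sums the order is four. Symmetry within each row leaves three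
distinct coefficients among the 24 permutations, and contracting indices with the orthonormality of
rows and columns determines them (`permWeight_values`). Block-preserving permutations have
coefficient about `d⁻²`, but the centering of `γ` cancels their contribution up to `O(d⁻⁴)`; mixed
ones are `O(d⁻⁴)`; block-exchanging ones give `d⁻³`. Hence `E[γγ']` is a product of two pairing
numbers times `d⁻³`, up to `O(d⁻⁴)` (`norm_integral_gamma_mul_sub_le`); for `d < 4` a trivial bound
suffices.

If that product is nonzero, the primed indices are those of the conjugate of `γ` up to symmetries of
`γ`, so `γ'` is the conjugate. Conversely, if `γ'` is the conjugate as a function, it may be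
replaced by `γ(l,k,n,m)`, and the product becomes `(1 + δₖₘ)(1 + δₗₙ)`. -/

instance instIsMulRightInvariantHaarU (d : ℕ) : (haarU d).IsMulRightInvariant := by
  have : (haarU d).IsHaarMeasure := by unfold haarU; infer_instance
  refine ⟨fun g => ?_⟩
  have : IsProbabilityMeasure ((haarU d).map (· * g)) :=
    Measure.isProbabilityMeasure_map (by fun_prop)
  -- A right translate of a left Haar measure is again left Haar, and the normalised one is unique.
  exact Measure.isHaarMeasure_eq_of_isProbabilityMeasure _ _

theorem continuous_entry {d : ℕ} (i j : Fin d) : Continuous fun Ψ : U d => Ψ.1 i j :=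
  (continuous_apply_apply i j).comp continuous_subtype_val

theorem integrable_haarU {d : ℕ} {f : U d → ℂ} (hf : Continuous f) : Integrable f (haarU d) :=
  integrableOn_univ.mp (hf.continuousOn.integrableOn_compact isCompact_univ)

theorem sum_star_mul_row {d : ℕ} (Ψ : U d) (i j : Fin d) :
    ∑ x, star (Ψ.1 i x) * Ψ.1 j x = if i = j then 1 else 0 := by
  have h := congrFun (congrFun (mem_unitaryGroup_iff.mp Ψ.2) j) i
  rw [mul_apply] at h
  simp only [star_apply, one_apply] at h
  simp only [mul_comm (star _), h, eq_comm]

theorem sum_star_mul_col {d : ℕ} (Ψ : U d) (x y : Fin d) :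
    ∑ j, star (Ψ.1 j x) * Ψ.1 j y = if x = y then 1 else 0 := by
  have h := congrFun (congrFun (mem_unitaryGroup_iff'.mp Ψ.2) x) y
  rw [mul_apply] at h
  simpa only [star_apply, one_apply] using h

variable {ι : Type*} [Fintype ι] {d : ℕ}

/-- The mixed moment `E ∏ₚ conj ψ(iₚ, uₚ) ψ(iₚ, vₚ)` of the entries of a Haar unitary matrix. -/
noncomputable def moment (i u v : ι → Fin d) : ℂ :=
  ∫ Ψ : U d, ∏ p, star (Ψ.1 (i p) (u p)) * Ψ.1 (i p) (v p) ∂(haarU d)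

theorem continuous_prod_entries (i u v : ι → Fin d) :
    Continuous fun Ψ : U d => ∏ p, star (Ψ.1 (i p) (u p)) * Ψ.1 (i p) (v p) :=
  continuous_finsetProd _ fun p _ =>
    (continuous_entry (i p) (u p)).star.mul (continuous_entry (i p) (v p))

/-- Entries commute, so the plain factors may be redistributed among positions that share a row. -/
theorem moment_comp_right (i u v : ι → Fin d) (h : Equiv.Perm ι) (hi : i ∘ h = i) :
    moment i u (v ∘ h) = moment i u v := by
  unfold moment
  congr 1
  ext Ψ
  rw [Finset.prod_mul_distrib, Finset.prod_mul_distrib]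
  congr 1
  rw [← Equiv.prod_comp h fun p => Ψ.1 (i p) (v p)]
  exact Finset.prod_congr rfl fun p _ => by rw [← congrFun hi p]; rfl

theorem moment_comp_left (i u v : ι → Fin d) (h : Equiv.Perm ι) (hi : i ∘ h = i) :
    moment i (u ∘ h) v = moment i u v := by
  unfold moment
  congr 1
  ext Ψ
  rw [Finset.prod_mul_distrib, Finset.prod_mul_distrib]
  congr 1
  rw [← Equiv.prod_comp h fun p => star (Ψ.1 (i p) (u p))]
  exact Finset.prod_congr rfl fun p _ => by rw [← congrFun hi p]; rfl

variable [DecidableEq ι]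

/-- A tensor with as many conjugate as plain indices, invariant under the unitary group. -/
def IsUnitaryInvariant (T : (ι → Fin d) → (ι → Fin d) → ℂ) : Prop :=
  ∀ (V : U d) (u v : ι → Fin d), T u v = ∑ u', ∑ v',
    ((∏ p, star (V.1 (u' p) (u p))) * ∏ p, V.1 (v' p) (v p)) * T u' v'

/-- Substitute `Ψ ↦ ΨV`, which acts on column indices only, and expand the products. -/
theorem isUnitaryInvariant_moment (i : ι → Fin d) : IsUnitaryInvariant (moment i) := by
  intro V u v
  have h1 : moment i u v = ∫ Ψ : U d, ∑ u' : ι → Fin d, ∑ v' : ι → Fin d,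
      ((∏ p, star (V.1 (u' p) (u p))) * ∏ p, V.1 (v' p) (v p)) *
        ∏ p, star (Ψ.1 (i p) (u' p)) * Ψ.1 (i p) (v' p) ∂(haarU d) := by
    rw [moment, ← integral_mul_right_eq_self _ V]
    congr 1
    ext Ψ
    have h2 : ∀ a b, (Ψ * V).1 a b = ∑ x, V.1 x b * Ψ.1 a x := fun a b => by
      simp only [Submonoid.coe_mul, mul_apply, mul_comm]
    simp only [h2, star_sum, star_mul', Finset.prod_mul_distrib]
    rw [Finset.prod_univ_sum, Finset.prod_univ_sum, Fintype.piFinset_univ, Finset.sum_mul_sum]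
    refine Finset.sum_congr rfl fun u' _ => Finset.sum_congr rfl fun v' _ => ?_
    rw [Finset.prod_mul_distrib, Finset.prod_mul_distrib]
    ring
  rw [h1, integral_finsetSum]
  · refine Finset.sum_congr rfl fun u' _ => ?_
    rw [integral_finsetSum]
    · exact Finset.sum_congr rfl fun v' _ => integral_const_mul _ _
    · exact fun v' _ => (integrable_haarU (continuous_prod_entries i u' v')).const_mul _
  · exact fun u' _ => integrable_finsetSum _ fun v' _ =>
      (integrable_haarU (continuous_prod_entries i u' v')).const_mul _

theorem IsUnitaryInvariant.sum {κ : Type*} (s : Finset κ)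
    {T : κ → (ι → Fin d) → (ι → Fin d) → ℂ} (hT : ∀ j ∈ s, IsUnitaryInvariant (T j)) :
    IsUnitaryInvariant fun u v => ∑ j ∈ s, T j u v := by
  intro V u v
  simp only [Finset.mul_sum]
  rw [Finset.sum_congr rfl fun j hj => hT j hj V u v, Finset.sum_comm]
  exact Finset.sum_congr rfl fun u' _ => Finset.sum_comm

/-- For the Leibniz rule at `V = 1`: all undifferentiated factors are Kronecker deltas, so only
position `q` remains free. -/
theorem sum_prod_erase_one_mul (u : ι → Fin d) (q : ι) (F : (ι → Fin d) → ℂ) :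
    ∑ u' : ι → Fin d, (∏ p ∈ univ.erase q, (1 : Matrix (Fin d) (Fin d) ℂ) (u' p) (u p)) * F u' =
      ∑ x, F (Function.update u q x) := by
  have h : ∀ x, F (Function.update u q x) =
      ∑ u' : ι → Fin d, (if u' = Function.update u q x then 1 else 0) * F u' := by simp
  simp only [h]
  rw [Finset.sum_comm]
  refine Finset.sum_congr rfl fun u' _ => ?_
  rw [← Finset.sum_mul]
  congr 1
  simp only [one_apply, Finset.prod_ite_zero, Finset.prod_const_one]
  by_cases hu : ∀ p ∈ univ.erase q, u' p = u p
  · rw [if_pos hu, Finset.sum_eq_single (u' q), if_pos]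
    · rw [Function.eq_update_iff]
      exact ⟨rfl, fun p hp => hu p (by simpa using hp)⟩
    · intro x _ hx
      rw [if_neg]
      rw [Function.eq_update_iff]
      exact fun h => hx h.1.symm
    · simp
  · rw [if_neg hu, Finset.sum_eq_zero]
    intro x _
    rw [if_neg]
    rw [Function.eq_update_iff]
    exact fun h => hu fun p hp => h.2 p (by simpa using hp)

theorem sum_prod_one_mul (u : ι → Fin d) (F : (ι → Fin d) → ℂ) :
    ∑ u' : ι → Fin d, (∏ p, (1 : Matrix (Fin d) (Fin d) ℂ) (u' p) (u p)) * F u' = F u := by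
  simp only [one_apply, Finset.prod_ite_zero, Finset.prod_const_one]
  simp [← funext_iff]

/-! ### Infinitesimal invariance and the permutation expansion. -/

section Exponential

attribute [local instance] Matrix.linftyOpNormedRing Matrix.linftyOpNormedAlgebra

theorem exists_unitary_curve (X : Matrix (Fin d) (Fin d) ℂ) (hX : star X = -X) :
    ∃ V : ℝ → U d, V 0 = 1 ∧ ∀ i j, HasDerivAt (fun t => (V t).1 i j) (X i j) 0 := by
  have hU : ∀ t : ℝ, NormedSpace.exp (t • X) ∈ unitaryGroup (Fin d) ℂ := fun t => by
    have hs : (t • X)ᴴ = -(t • X) := by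
      rw [conjTranspose_smul, ← star_eq_conjTranspose, hX, star_trivial, smul_neg]
    rw [mem_unitaryGroup_iff', star_eq_conjTranspose, ← exp_conjTranspose, hs,
      ← Matrix.exp_add_of_commute _ _ (Commute.refl (t • X)).neg_left, neg_add_cancel,
      NormedSpace.exp_zero]
  refine ⟨fun t => ⟨_, hU t⟩, Subtype.ext (by simp), fun i j => ?_⟩
  have h := hasDerivAt_exp_smul_const (𝕂 := ℝ) X (0 : ℝ)
  rw [zero_smul, NormedSpace.exp_zero, one_mul] at h
  exact hasDerivAt_pi.mp (hasDerivAt_pi.mp h i) j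

end Exponential

/-- Differentiate the invariance identity at `t = 0` along `exp(tX)`; its left side is constant. -/
theorem IsUnitaryInvariant.lie_skew {T : (ι → Fin d) → (ι → Fin d) → ℂ}
    (hT : IsUnitaryInvariant T) (X : Matrix (Fin d) (Fin d) ℂ) (hX : star X = -X)
    (u v : ι → Fin d) :
    ∑ q, ∑ x, X x (v q) * T u (Function.update v q x) =
      ∑ q, ∑ x, X (u q) x * T (Function.update u q x) v := by
  obtain ⟨V, hV0, hV⟩ := exists_unitary_curve X hX
  have hs : ∀ i j, star (X i j) = -X j i := fun i j => congrFun (congrFun hX j) i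
  have hone : ∀ i j,
      star ((1 : Matrix (Fin d) (Fin d) ℂ) i j) = (1 : Matrix (Fin d) (Fin d) ℂ) i j :=
    fun i j => by simp [one_apply, apply_ite]
  have hA : ∀ u' : ι → Fin d, HasDerivAt (fun t => ∏ p, star ((V t).1 (u' p) (u p)))
      (∑ q, (∏ p ∈ univ.erase q, (1 : Matrix (Fin d) (Fin d) ℂ) (u' p) (u p)) *
        -X (u q) (u' q)) 0 := fun u' => by
    have h := HasDerivAt.fun_finsetProd (u := univ) (x := (0 : ℝ))
      (f := fun p t => star ((V t).1 (u' p) (u p)))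
      (fun p _ => (hV (u' p) (u p)).star)
    simp only [hV0, OneMemClass.coe_one, hone, hs, smul_eq_mul] at h
    exact h
  have hB : ∀ v' : ι → Fin d, HasDerivAt (fun t => ∏ p, (V t).1 (v' p) (v p))
      (∑ q, (∏ p ∈ univ.erase q, (1 : Matrix (Fin d) (Fin d) ℂ) (v' p) (v p)) *
        X (v' q) (v q)) 0 := fun v' => by
    have h := HasDerivAt.fun_finsetProd (u := univ) (x := (0 : ℝ))
      (f := fun p t => (V t).1 (v' p) (v p))
      (fun p _ => hV (v' p) (v p))
    simp only [hV0, smul_eq_mul] at h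
    exact h
  have hsum : HasDerivAt (fun t => ∑ u' : ι → Fin d, ∑ v' : ι → Fin d,
      ((∏ p, star ((V t).1 (u' p) (u p))) * ∏ p, (V t).1 (v' p) (v p)) * T u' v') _ 0 :=
    HasDerivAt.fun_sum fun u' _ => HasDerivAt.fun_sum fun v' _ =>
      ((hA u').mul (hB v')).mul_const (T u' v')
  have hconst : HasDerivAt (fun t => ∑ u' : ι → Fin d, ∑ v' : ι → Fin d,
      ((∏ p, star ((V t).1 (u' p) (u p))) * ∏ p, (V t).1 (v' p) (v p)) * T u' v') 0 0 := by
    simp only [← hT _ u v]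
    exact hasDerivAt_const _ _
  have h := hsum.unique hconst
  simp only [hV0, OneMemClass.coe_one, hone, add_mul, Finset.sum_add_distrib] at h
  have h1 : ∑ u' : ι → Fin d, ∑ v' : ι → Fin d,
      (∑ q, (∏ p ∈ univ.erase q, (1 : Matrix (Fin d) (Fin d) ℂ) (u' p) (u p)) * -X (u q) (u' q)) *
        (∏ p, (1 : Matrix (Fin d) (Fin d) ℂ) (v' p) (v p)) * T u' v' =
      -∑ q, ∑ x, X (u q) x * T (Function.update u q x) v := by
    simp only [mul_assoc, ← Finset.mul_sum, sum_prod_one_mul]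
    simp only [Finset.sum_mul, mul_assoc]
    rw [Finset.sum_comm, ← Finset.sum_neg_distrib]
    refine Finset.sum_congr rfl fun q _ => ?_
    rw [sum_prod_erase_one_mul u q fun u' => -X (u q) (u' q) * T u' v]
    simp
  have h2 : ∑ u' : ι → Fin d, ∑ v' : ι → Fin d,
      (∏ p, (1 : Matrix (Fin d) (Fin d) ℂ) (u' p) (u p)) *
      (∑ q, (∏ p ∈ univ.erase q, (1 : Matrix (Fin d) (Fin d) ℂ) (v' p) (v p)) * X (v' q) (v q)) *
        T u' v' =
      ∑ q, ∑ x, X x (v q) * T u (Function.update v q x) := by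
    simp only [mul_assoc, ← Finset.mul_sum]
    rw [sum_prod_one_mul u]
    simp only [Finset.sum_mul, mul_assoc]
    rw [Finset.sum_comm]
    refine Finset.sum_congr rfl fun q _ => ?_
    rw [sum_prod_erase_one_mul v q fun v' => X (v' q) (v q) * T u v']
    simp
  rw [h1, h2] at h
  linear_combination h

/-- The infinitesimal form of unitary invariance. -/
theorem IsUnitaryInvariant.lie {T : (ι → Fin d) → (ι → Fin d) → ℂ}
    (hT : IsUnitaryInvariant T) (X : Matrix (Fin d) (Fin d) ℂ) (u v : ι → Fin d) :
    ∑ q, ∑ x, X x (v q) * T u (Function.update v q x) =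
      ∑ q, ∑ x, X (u q) x * T (Function.update u q x) v := by
  -- The identity is complex-linear in `X`, and `X` is half the sum of the skew matrix `X - X*` and
  -- `-i` times the skew matrix `i(X + X*)`.
  have h1 := hT.lie_skew (X - star X) (by rw [star_sub, star_star, neg_sub]) u v
  have h2 := hT.lie_skew (Complex.I • (X + star X)) (by
    rw [star_smul, star_add, star_star, Complex.star_def, Complex.conj_I, neg_smul, add_comm]) u v
  simp only [Matrix.sub_apply, Matrix.smul_apply, Matrix.add_apply, smul_eq_mul, sub_mul, mul_assoc, add_mul,
    ← Finset.mul_sum, Finset.sum_sub_distrib, Finset.sum_add_distrib] at h1 h2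
  have h3 := mul_left_cancel₀ Complex.I_ne_zero h2
  linear_combination (h1 + h3) / 2

theorem IsUnitaryInvariant.lie_single {T : (ι → Fin d) → (ι → Fin d) → ℂ}
    (hT : IsUnitaryInvariant T) (a b : Fin d) (u v : ι → Fin d) :
    ∑ q with v q = a, T u (Function.update v q b) =
      ∑ q with u q = b, T (Function.update u q a) v := by
  have h := hT.lie (Matrix.single b a 1) u v
  simpa [single_apply, ite_and, Finset.sum_filter, eq_comm] using h

/-- The tensor vanishes when a value occurs among the conjugate indices only. -/
theorem IsUnitaryInvariant.eq_zero {T : (ι → Fin d) → (ι → Fin d) → ℂ}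
    (hT : IsUnitaryInvariant T) {u v : ι → Fin d} (p : ι) (hp : ∀ q, v q ≠ u p) : T u v = 0 := by
  have h := hT.lie_single (u p) (u p) u v
  rw [Finset.filter_false_of_mem fun q _ => hp q, Finset.sum_empty,
    Finset.sum_congr rfl (g := fun _ => T u v) fun q hq => by
      rw [← (Finset.mem_filter.mp hq).2, Function.update_eq_self], Finset.sum_const] at h
  refine (smul_eq_zero.mp h.symm).resolve_left ?_
  rw [Finset.card_eq_zero, ← ne_eq, ← Finset.nonempty_iff_ne_empty]
  exact ⟨p, by simp⟩

/-- A conjugate index may be moved to an unused value `b`. -/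
theorem IsUnitaryInvariant.eq_sum_update {T : (ι → Fin d) → (ι → Fin d) → ℂ}
    (hT : IsUnitaryInvariant T) (u v : ι → Fin d) (p : ι) {b : Fin d} (hb : ∀ q, u q ≠ b) :
    T u v = ∑ q with v q = u p, T (Function.update u p b) (Function.update v q b) := by
  rw [hT.lie_single (u p) b]
  have : (univ.filter fun q => Function.update u p b q = b) = {p} := by
    ext q
    by_cases hq : q = p
    · simp [hq]
    · simp [hq, hb]
  simp [this]

theorem IsUnitaryInvariant.comp_perm {T : (ι → Fin d) → (ι → Fin d) → ℂ}
    (hT : IsUnitaryInvariant T) (τ : Equiv.Perm (Fin d)) (u v : ι → Fin d) :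
    T (τ ∘ u) (τ ∘ v) = T u v := by
  let M : Matrix (Fin d) (Fin d) ℂ := Matrix.of fun x y => if x = τ y then 1 else 0
  have hM : M ∈ unitaryGroup (Fin d) ℂ := by
    rw [mem_unitaryGroup_iff']
    ext x y
    rw [mul_apply, one_apply]
    simp [star_apply, M, apply_ite, eq_comm]
  have hone : ∀ x y, M x (τ.symm y) = (1 : Matrix (Fin d) (Fin d) ℂ) x y := fun x y => by
    simp [M, one_apply]
  have hone' : ∀ x y, star ((1 : Matrix (Fin d) (Fin d) ℂ) x y) = (1 : Matrix _ _ ℂ) x y :=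
    fun x y => by simp [one_apply, apply_ite]
  have h := hT ⟨M, hM⟩ (τ.symm ∘ (τ ∘ u)) (τ.symm ∘ (τ ∘ v))
  simp only [Function.comp_apply (f := τ.symm), hone, hone', mul_assoc, ← Finset.mul_sum,
    sum_prod_one_mul] at h
  rw [← h]
  congr 1 <;> ext p <;> simp

/-- Two injective tuples differ by a permutation of the values, and permutation matrices are
unitary. -/
theorem IsUnitaryInvariant.eq_of_injective {T : (ι → Fin d) → (ι → Fin d) → ℂ}
    (hT : IsUnitaryInvariant T) {u e : ι → Fin d} (hu : Function.Injective u)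
    (he : Function.Injective e) (σ : Equiv.Perm ι) : T u (u ∘ σ) = T e (e ∘ σ) := by
  classical
  let f : {x // x ∈ Set.range e} ≃ {x // x ∈ Set.range u} :=
    (Equiv.ofInjective e he).symm.trans (Equiv.ofInjective u hu)
  have hf : f.extendSubtype ∘ e = u := by
    ext p
    rw [Function.comp_apply, Equiv.extendSubtype_apply_of_mem f (e p) ⟨p, rfl⟩]
    simp [f]
  rw [← hT.comp_perm f.extendSubtype e, ← Function.comp_assoc, hf]

/-- Each permutation tensor obeys the recursion of `IsUnitaryInvariant.eq_sum_update`: only `q = σ⁻¹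
p` can contribute. This is the inductive step of the expansion. -/
theorem sum_ite_update_eq_comp (w : ℂ) (u v : ι → Fin d) (p : ι) {b : Fin d}
    (hb : ∀ q, u q ≠ b) (σ : Equiv.Perm ι) :
    (∑ q with v q = u p,
      if Function.update v q b = Function.update u p b ∘ σ then w else 0) =
      if v = u ∘ σ then w else 0 := by
  have key : ∀ q, Function.update v q b = Function.update u p b ∘ σ ↔
      σ q = p ∧ ∀ r, r ≠ q → v r = u (σ r) := by
    intro q
    rw [Function.update_eq_iff]
    constructor
    · rintro ⟨h1, h2⟩
      have hq : σ q = p := by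
        by_contra hne
        rw [Function.comp_apply, Function.update_of_ne hne] at h1
        exact hb _ h1.symm
      refine ⟨hq, fun r hr => ?_⟩
      rw [h2 r hr, Function.comp_apply, Function.update_of_ne]
      exact fun h => hr (σ.injective (h.trans hq.symm))
    · rintro ⟨hq, h⟩
      refine ⟨by simp [hq], fun r hr => ?_⟩
      rw [h r hr, Function.comp_apply, Function.update_of_ne]
      exact fun h => hr (σ.injective (h.trans hq.symm))
  simp only [key, Finset.sum_filter]
  rw [Finset.sum_eq_single (σ.symm p)]
  · simp only [Equiv.apply_symm_apply, true_and, ← ite_and]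
    congr 1
    rw [eq_iff_iff, funext_iff]
    refine ⟨fun h r => ?_, fun h => ⟨by simp [h], fun r _ => h r⟩⟩
    by_cases hr : r = σ.symm p
    · rw [hr, h.1]; simp
    · exact h.2 r hr
  · intro q _ hq
    have : σ q ≠ p := fun h => hq (by simp [← h])
    simp [this]
  · simp

/-- Every unitarily invariant tensor is a combination of permutations of the indices. -/
theorem IsUnitaryInvariant.eq_sum_perm {T : (ι → Fin d) → (ι → Fin d) → ℂ}
    (hT : IsUnitaryInvariant T) {e : ι → Fin d} (he : Function.Injective e) (u v : ι → Fin d) :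
    T u v = ∑ σ : Equiv.Perm ι, if v = u ∘ σ then T e (e ∘ σ) else 0 := by
  -- Induction on the number of repetitions in `u`. If `u` repeats a value, some `b` is unused
  -- because the order is at most `d`, and moving one repeated index to `b` adds a distinct value.
  induction hk : Fintype.card ι - (univ.image u).card using Nat.strong_induction_on
    generalizing u v with
  | _ k ih =>
  by_cases hu : Function.Injective u
  · by_cases hv : ∀ p, ∃ q, v q = u p
    · choose f hf using hv
      have hfi : Function.Injective f := fun p p' h => hu (by rw [← hf, ← hf, h])
      let σ : Equiv.Perm ι := (Equiv.ofBijective f (Finite.injective_iff_bijective.mp hfi)).symm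
      have hσ : v = u ∘ σ := by
        ext q
        have h := hf (σ q)
        rw [show f (σ q) = q from
          (Equiv.ofBijective f (Finite.injective_iff_bijective.mp hfi)).apply_symm_apply q] at h
        rw [h, Function.comp_apply]
      rw [Finset.sum_eq_single σ, if_pos hσ, hσ, hT.eq_of_injective hu he]
      · intro τ _ hτ
        rw [if_neg]
        intro h
        refine hτ (Equiv.ext fun q => hu ?_)
        exact (congrFun h q).symm.trans (congrFun hσ q)
      · simp
    · push Not at hv
      obtain ⟨p, hp⟩ := hv
      rw [hT.eq_zero p hp, Finset.sum_eq_zero]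
      intro σ _
      rw [if_neg]
      intro h
      refine hp (σ.symm p) ?_
      rw [h]; simp
  · simp only [Function.Injective, not_forall] at hu
    obtain ⟨p, p', hpp, hne⟩ := hu
    have hlt : (univ.image u).card < Fintype.card ι := by
      refine lt_of_le_of_ne Finset.card_image_le fun h => hne ?_
      exact Finset.card_image_iff.mp h (by simp) (by simp) hpp
    have hd : Fintype.card ι ≤ d := by simpa using Fintype.card_le_of_injective e he
    obtain ⟨b, hb⟩ : ∃ b, b ∉ univ.image u := by
      by_contra! h
      rw [Finset.eq_univ_of_forall h, Finset.card_univ, Fintype.card_fin] at hlt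
      omega
    have hb' : ∀ q, u q ≠ b := by simpa using hb
    have himg : univ.image (Function.update u p b) = insert b (univ.image u) := by
      ext x
      simp only [Finset.mem_image, Finset.mem_univ, true_and, Finset.mem_insert]
      constructor
      · rintro ⟨q, rfl⟩
        by_cases hq : q = p
        · simp [hq]
        · simp [hq]
      · rintro (rfl | ⟨q, rfl⟩)
        · exact ⟨p, by simp⟩
        · by_cases hq : q = p
          · exact ⟨p', by rw [Function.update_of_ne (Ne.symm hne), hq, hpp]⟩
          · exact ⟨q, by simp [hq]⟩
    rw [hT.eq_sum_update u v p hb']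
    rw [Finset.sum_congr rfl fun q _ => ih _ (by
      rw [himg, Finset.card_insert_of_notMem hb]; omega) _ _ rfl, Finset.sum_comm]
    exact Finset.sum_congr rfl fun σ _ => sum_ite_update_eq_comp _ u v p hb' σ

theorem update_update_eq_comp_swap {κ : Type*} [DecidableEq κ] (v : κ → Fin d) {q r : κ} (hr : r ≠ q) :
    Function.update (Function.update v q (v r)) r (v q) = v ∘ Equiv.swap q r := by
  ext s
  by_cases hs : s = r
  · simp [hs]
  · by_cases hq : s = q
    · subst hq; simp [hs]
    · simp [hs, hq, Equiv.swap_apply_of_ne_of_ne hq hs]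

/-- The contraction of a unitarily invariant tensor over a pair of matched indices. -/
theorem IsUnitaryInvariant.sum_update {T : (ι → Fin d) → (ι → Fin d) → ℂ}
    (hT : IsUnitaryInvariant T) {u v : ι → Fin d} (hu : Function.Injective u)
    (hv : Function.Injective v) {p q : ι} (hpq : v q = u p) :
    ∑ k, T (Function.update u p k) (Function.update v q k) =
      d * T u v + ∑ r ∈ univ.erase q, T u (v ∘ Equiv.swap q r) := by
  -- For `k ≠ u p`, moving the index back to `u p` gives `T u v`, plus a transposed term when `k`
  -- already occurs as some `v r`. Summing over `k` gives `d` copies and each transposition once.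
  have key : ∀ k, T (Function.update u p k) (Function.update v q k) =
      T u v + ∑ r ∈ univ.erase q, if v r = k then T u (v ∘ Equiv.swap q r) else 0 := by
    intro k
    by_cases hk : k = u p
    · rw [hk, ← hpq, Function.update_eq_self, hpq, Function.update_eq_self, Finset.sum_eq_zero,
        add_zero]
      intro r hr
      rw [if_neg]
      exact fun h => (Finset.mem_erase.mp hr).1 (hv (h.trans hpq.symm))
    · have hb : ∀ s, Function.update u p k s ≠ u p := by
        intro s
        by_cases hs : s = p
        · simpa [hs] using hk
        · rw [Function.update_of_ne hs]
          exact fun h => hs (hu h)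
      rw [hT.eq_sum_update _ _ p hb, Function.update_self, Function.update_idem,
        Function.update_eq_self, Finset.sum_filter, ← Finset.add_sum_erase _ _ (mem_univ q),
        Function.update_self, if_pos rfl, Function.update_idem, ← hpq, Function.update_eq_self]
      congr 1
      refine Finset.sum_congr rfl fun r hr => ?_
      have hr' := (Finset.mem_erase.mp hr).1
      rw [Function.update_of_ne hr']
      split_ifs with h
      · rw [← h, update_update_eq_comp_swap v hr']
      · rfl
  rw [Finset.sum_congr rfl fun k _ => key k, Finset.sum_add_distrib, Finset.sum_comm]
  simp

end RandomUnitary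

namespace RandomUnitary

open MeasureTheory Matrix Finset

variable {d : ℕ}

/-! ### Moments from a single row. -/

/-- The moment in which all the factors come from one row, summed over the rows. -/
noncomputable def rowTensor {n : ℕ} (u v : Fin n → Fin d) : ℂ := ∑ j, moment (fun _ => j) u v

theorem isUnitaryInvariant_rowTensor (n : ℕ) :
    IsUnitaryInvariant (rowTensor : (Fin n → Fin d) → (Fin n → Fin d) → ℂ) :=
  .sum _ fun _ _ => isUnitaryInvariant_moment _

theorem rowTensor_comp_right {n : ℕ} (u v : Fin n → Fin d) (σ : Equiv.Perm (Fin n)) :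
    rowTensor u (v ∘ σ) = rowTensor u v :=
  Finset.sum_congr rfl fun _ _ => moment_comp_right _ _ _ _ rfl

theorem rowTensor_zero (u v : Fin 0 → Fin d) : rowTensor u v = d := by
  simp [rowTensor, moment]

theorem sum_rowTensor_update {n : ℕ} (u v : Fin (n + 1) → Fin d) :
    ∑ k, rowTensor (Function.update u 0 k) (Function.update v 0 k) =
      rowTensor (u ∘ Fin.succ) (v ∘ Fin.succ) := by
  unfold rowTensor moment
  rw [Finset.sum_comm]
  refine Finset.sum_congr rfl fun j _ => ?_
  rw [← integral_finsetSum]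
  · congr 1
    ext Ψ
    simp only [Fin.prod_univ_succ, Function.update_self, ne_eq, Fin.succ_ne_zero,
      not_false_eq_true, Function.update_of_ne, ← Finset.sum_mul, sum_star_mul_row, if_true,
      one_mul, Function.comp_apply]
  · exact fun k _ => integrable_haarU (continuous_prod_entries _ _ _)

/-- Contracting one pair uses that rows have norm one; by symmetry each of the `n` transposed terms
equals the original. -/
theorem rowTensor_self_succ {n : ℕ} {e : Fin (n + 1) → Fin d} (he : Function.Injective e) :
    (d + n) * rowTensor e e = rowTensor (e ∘ Fin.succ) (e ∘ Fin.succ) := by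
  rw [← sum_rowTensor_update, (isUnitaryInvariant_rowTensor _).sum_update he he rfl]
  simp [rowTensor_comp_right, add_mul]

theorem rowTensor_self_two {e : Fin 2 → Fin d} (he : Function.Injective e) :
    ((d : ℂ) + 1) * rowTensor e e = 1 := by
  have h1 := rowTensor_self_succ he
  have h0 := rowTensor_self_succ (he.comp (Fin.succ_injective _))
  rw [rowTensor_zero] at h0
  have hd : (d : ℂ) ≠ 0 := Nat.cast_ne_zero.mpr (e 0).pos.ne'
  have h2 := mul_left_cancel₀ hd ((by simpa using h0 : (d : ℂ) * _ = d).trans (mul_one _).symm)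
  rw [Nat.cast_one] at h1
  exact h1.trans h2

theorem rowTensor_self_three {e : Fin 3 → Fin d} (he : Function.Injective e) :
    ((d : ℂ) + 1) * ((d + 2) * rowTensor e e) = 1 := by
  have h := rowTensor_self_succ he
  rw [Nat.cast_two] at h
  rw [h]
  exact rowTensor_self_two (he.comp (Fin.succ_injective _))

/-- The number of ways, in `{0, 1, 2}`, to match `k, m` with `l, n`. -/
def pairing (k m l n : Fin d) : ℂ :=
  (if k = l ∧ m = n then 1 else 0) + (if m = l ∧ k = n then 1 else 0)

theorem rowTensor_two (hd : 2 ≤ d) (k m l n : Fin d) :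
    rowTensor ![k, m] ![l, n] = pairing k m l n / (d + 1) := by
  have he := Fin.castLE_injective hd
  rw [(isUnitaryInvariant_rowTensor 2).eq_sum_perm he]
  simp only [rowTensor_comp_right]
  have h : rowTensor (Fin.castLE hd) (Fin.castLE hd) = 1 / ((d : ℂ) + 1) := by
    rw [eq_div_iff (Nat.cast_add_one_ne_zero d), mul_comm]
    exact rowTensor_self_two he
  rw [h, show (univ : Finset (Equiv.Perm (Fin 2))) = {1, Equiv.swap 0 1} by decide,
    Finset.sum_pair (by decide)]
  simp [pairing, funext_iff, Fin.forall_fin_two, eq_comm, add_div, ite_div, and_comm]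

/-! ### Moments from two rows and their coefficients. -/

/-- The moment in which the first two pairs of factors come from one row and the last two from
another, summed over the rows. -/
noncomputable def twoRowTensor (u v : Fin 4 → Fin d) : ℂ :=
  ∑ j, ∑ j', moment (fun p => if p < 2 then j else j') u v

theorem isUnitaryInvariant_twoRowTensor :
    IsUnitaryInvariant (twoRowTensor : (Fin 4 → Fin d) → (Fin 4 → Fin d) → ℂ) :=
  .sum _ fun _ _ => .sum _ fun _ _ => isUnitaryInvariant_moment _

theorem twoRowTensor_comp_right (u v : Fin 4 → Fin d) {h : Equiv.Perm (Fin 4)}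
    (hh : ∀ p, h p < 2 ↔ p < 2) : twoRowTensor u (v ∘ h) = twoRowTensor u v :=
  Finset.sum_congr rfl fun _ _ => Finset.sum_congr rfl fun _ _ =>
    moment_comp_right _ _ _ _ (by ext p; simp [hh])

theorem twoRowTensor_comp_left (u v : Fin 4 → Fin d) {h : Equiv.Perm (Fin 4)}
    (hh : ∀ p, h p < 2 ↔ p < 2) : twoRowTensor (u ∘ h) v = twoRowTensor u v :=
  Finset.sum_congr rfl fun _ _ => Finset.sum_congr rfl fun _ _ =>
    moment_comp_left _ _ _ _ (by ext p; simp [hh])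

/-- Row normalisation removes the contracted pair; summing over `j` then makes the other pair of
that row a column inner product. -/
theorem sum_twoRowTensor_update_zero_zero (u v : Fin 4 → Fin d) :
    ∑ k, twoRowTensor (Function.update u 0 k) (Function.update v 0 k) =
      (if u 1 = v 1 then 1 else 0) * rowTensor ![u 2, u 3] ![v 2, v 3] := by
  have hi : ∀ j j' k, Integrable (fun Ψ : U d => ∏ p : Fin 4,
      star (Ψ.1 (if p < 2 then j else j') (Function.update u 0 k p)) *
        Ψ.1 (if p < 2 then j else j') (Function.update v 0 k p)) (haarU d) := fun j j' k =>
    integrable_haarU (continuous_prod_entries (fun p => if p < 2 then j else j') _ _)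
  unfold twoRowTensor rowTensor moment
  rw [Finset.sum_comm, Finset.sum_congr rfl fun _ _ => Finset.sum_comm, Finset.sum_comm,
    Finset.mul_sum]
  refine Finset.sum_congr rfl fun j' _ => ?_
  rw [← integral_const_mul, Finset.sum_congr rfl fun j _ =>
    (integral_finsetSum _ fun k _ => hi j j' k).symm, ← integral_finsetSum]
  · congr 1
    ext Ψ
    have hs := sum_star_mul_col Ψ (u 1) (v 1)
    simp only [Fin.prod_univ_four, Fin.prod_univ_two, Function.update_self, Fin.isValue,
      Matrix.cons_val_zero, Matrix.cons_val_one, ne_eq, one_ne_zero, not_false_eq_true,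
      Function.update_of_ne, show (2 : Fin 4) ≠ 0 by decide, show (3 : Fin 4) ≠ 0 by decide,
      show (0 : Fin 4) < 2 by decide, show (1 : Fin 4) < 2 by decide,
      show ¬ (2 : Fin 4) < 2 by decide, show ¬ (3 : Fin 4) < 2 by decide, if_true, if_false,
      ← Finset.sum_mul, sum_star_mul_row, one_mul, hs]
    rw [mul_assoc]
  · exact fun j _ => integrable_finsetSum _ fun k _ => hi j j' k

/-- Contracting across the blocks gives the inner product of rows `j` and `j'`, which forces `j =
j'` and merges the rest into one row. -/
theorem sum_twoRowTensor_update_zero_two (u v : Fin 4 → Fin d) :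
    ∑ k, twoRowTensor (Function.update u 0 k) (Function.update v 2 k) =
      rowTensor ![u 1, u 2, u 3] ![v 0, v 1, v 3] := by
  have hi : ∀ j j' k, Integrable (fun Ψ : U d => ∏ p : Fin 4,
      star (Ψ.1 (if p < 2 then j else j') (Function.update u 0 k p)) *
        Ψ.1 (if p < 2 then j else j') (Function.update v 2 k p)) (haarU d) := fun j j' k =>
    integrable_haarU (continuous_prod_entries (fun p => if p < 2 then j else j') _ _)
  unfold twoRowTensor rowTensor moment
  rw [Finset.sum_comm, Finset.sum_congr rfl fun _ _ => Finset.sum_comm]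
  refine Finset.sum_congr rfl fun j _ => ?_
  rw [Finset.sum_congr rfl fun j' _ =>
    (integral_finsetSum _ fun k _ => hi j j' k).symm, ← integral_finsetSum]
  · congr 1
    ext Ψ
    have key : ∀ j', ∑ k, ∏ p : Fin 4,
        star (Ψ.1 (if p < 2 then j else j') (Function.update u 0 k p)) *
          Ψ.1 (if p < 2 then j else j') (Function.update v 2 k p) =
        (if j = j' then 1 else 0) * (star (Ψ.1 j (u 1)) * Ψ.1 j (v 0) *
          (star (Ψ.1 j' (u 2)) * Ψ.1 j (v 1)) * (star (Ψ.1 j' (u 3)) * Ψ.1 j' (v 3))) := by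
      intro j'
      rw [← sum_star_mul_row Ψ j j', Finset.sum_mul]
      refine Finset.sum_congr rfl fun k _ => ?_
      simp only [Fin.prod_univ_four, Function.update_self, Fin.isValue, ne_eq, one_ne_zero,
        not_false_eq_true, Function.update_of_ne, show (2 : Fin 4) ≠ 0 by decide,
        show (3 : Fin 4) ≠ 0 by decide, show (0 : Fin 4) ≠ 2 by decide,
        show (1 : Fin 4) ≠ 2 by decide, show (3 : Fin 4) ≠ 2 by decide,
        show (0 : Fin 4) < 2 by decide, show (1 : Fin 4) < 2 by decide,
        show ¬ (2 : Fin 4) < 2 by decide, show ¬ (3 : Fin 4) < 2 by decide, if_true, if_false]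
      ring
    simp only [key]
    simp [Fin.prod_univ_three]
  · exact fun j' _ => integrable_finsetSum _ fun k _ => hi j j' k

/-- The permutations of four points that map `{0, 1}` to itself. -/
def blockPerms : Finset (Equiv.Perm (Fin 4)) :=
  {1, Equiv.swap 0 1, Equiv.swap 2 3, Equiv.swap 0 1 * Equiv.swap 2 3}

/-- The permutations of four points that exchange `{0, 1}` and `{2, 3}`. -/
def crossPerms : Finset (Equiv.Perm (Fin 4)) :=
  {Equiv.swap 0 2 * Equiv.swap 1 3, Equiv.swap 0 2 * Equiv.swap 1 3 * Equiv.swap 0 1,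
    Equiv.swap 0 2 * Equiv.swap 1 3 * Equiv.swap 2 3,
    Equiv.swap 0 2 * Equiv.swap 1 3 * (Equiv.swap 0 1 * Equiv.swap 2 3)}

theorem lt_two_iff_of_mem_blockPerms : ∀ h ∈ blockPerms, ∀ p, h p < 2 ↔ p < 2 := by decide

set_option maxRecDepth 4000 in
-- The block subgroup has three double cosets in the symmetric group: itself, the exchanging
-- permutations, and the remaining sixteen, represented by `swap 0 2`.
theorem exists_block_decomposition : ∀ σ : Equiv.Perm (Fin 4), ∃ h ∈ blockPerms, ∃ h' ∈ blockPerms,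
    σ = h * ((if σ ∈ blockPerms then 1 else if σ ∈ crossPerms then
      Equiv.swap 0 2 * Equiv.swap 1 3 else Equiv.swap 0 2) * h') := by decide

/-- The coefficient of the permutation `σ` in the expansion of `twoRowTensor`. -/
noncomputable def permWeight (e : Fin 4 → Fin d) (σ : Equiv.Perm (Fin 4)) : ℂ :=
  twoRowTensor e (e ∘ σ)

theorem permWeight_block_mul {e : Fin 4 → Fin d} (he : Function.Injective e)
    {h h' : Equiv.Perm (Fin 4)} (hh : h ∈ blockPerms) (hh' : h' ∈ blockPerms)
    (σ : Equiv.Perm (Fin 4)) :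
    permWeight e (h * (σ * h')) = permWeight e σ := by
  have h1 : e ∘ ⇑(h * (σ * h')) = ((e ∘ h) ∘ σ) ∘ h' := by ext; simp
  unfold permWeight
  rw [h1, twoRowTensor_comp_right _ _ (lt_two_iff_of_mem_blockPerms _ hh'),
    ← twoRowTensor_comp_left e _ (lt_two_iff_of_mem_blockPerms _ hh),
    isUnitaryInvariant_twoRowTensor.eq_of_injective (he.comp h.injective) he]

theorem permWeight_eq_ite {e : Fin 4 → Fin d} (he : Function.Injective e)
    (σ : Equiv.Perm (Fin 4)) :
    permWeight e σ = if σ ∈ blockPerms then permWeight e 1 else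
      if σ ∈ crossPerms then permWeight e (Equiv.swap 0 2 * Equiv.swap 1 3) else
        permWeight e (Equiv.swap 0 2) := by
  obtain ⟨h, hh, h', hh', hσ⟩ := exists_block_decomposition σ
  conv_lhs => rw [hσ, permWeight_block_mul he hh hh']
  split_ifs <;> rfl

theorem permWeight_contraction {e : Fin 4 → Fin d} (he : Function.Injective e)
    (σ : Equiv.Perm (Fin 4)) {p q : Fin 4} (hpq : σ q = p) :
    ∑ k, twoRowTensor (Function.update e p k) (Function.update (e ∘ σ) q k) =
      d * permWeight e σ +
        ∑ r ∈ univ.erase q, permWeight e (σ * Equiv.swap q r) :=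
  isUnitaryInvariant_twoRowTensor.sum_update he (he.comp σ.injective) (congrArg e hpq)

/-- Three contractions, at `1`, `swap 1 2` and `swap 0 2 * swap 1 3`, give three equations for the
three coefficients. In the second the column inner product vanishes, whence the zero right side. -/
theorem permWeight_linear_system {e : Fin 4 → Fin d} (he : Function.Injective e) :
    ((d : ℂ) + 1) * (((d : ℂ) + 1) * permWeight e 1 +
        2 * permWeight e (Equiv.swap 0 2)) = 1 ∧
      ((d : ℂ) + 2) * permWeight e (Equiv.swap 0 2) +
        permWeight e (Equiv.swap 0 2 * Equiv.swap 1 3) = 0 ∧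
      ((d : ℂ) + 1) * ((d + 2) * (((d : ℂ) + 1) *
        permWeight e (Equiv.swap 0 2 * Equiv.swap 1 3) +
          2 * permWeight e (Equiv.swap 0 2))) = 1 := by
  have hw := permWeight_eq_ite he
  have hne : ∀ p q : Fin 4, p ≠ q → e p ≠ e q := fun p q h h' => h (he h')
  have e0 : (univ.erase 0 : Finset (Fin 4)) = {1, 2, 3} := by decide
  have e2 : (univ.erase 2 : Finset (Fin 4)) = {0, 1, 3} := by decide
  refine ⟨?_, ?_, ?_⟩
  · have h := permWeight_contraction he 1 (p := 0) (q := 0) rfl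
    rw [sum_twoRowTensor_update_zero_zero, e0, Finset.sum_insert (by decide),
      Finset.sum_insert (by decide), Finset.sum_singleton, hw 1, hw (1 * Equiv.swap 0 1),
      hw (1 * Equiv.swap 0 2), hw (1 * Equiv.swap 0 3), if_pos (by simp), if_pos (by decide), if_pos (by decide),
      if_neg (by decide), if_neg (by decide), if_neg (by decide), if_neg (by decide)] at h
    have hE : Function.Injective ![e 2, e 3] := by
      have := hne 2 3 (by decide)
      intro p q
      fin_cases p <;> fin_cases q <;> simp [this, this.symm]
    have hr := rowTensor_self_two hE
    simp only [Equiv.Perm.coe_one, Function.comp_apply, id, one_mul] at h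
    rw [h] at hr
    linear_combination hr
  · have h := permWeight_contraction he (Equiv.swap 1 2) (p := 0) (q := 0) (by decide)
    rw [sum_twoRowTensor_update_zero_zero, e0, Finset.sum_insert (by decide),
      Finset.sum_insert (by decide), Finset.sum_singleton, hw (Equiv.swap 1 2),
      hw (Equiv.swap 1 2 * Equiv.swap 0 1),
      hw (Equiv.swap 1 2 * Equiv.swap 0 2), hw (Equiv.swap 1 2 * Equiv.swap 0 3),
      if_neg (by simpa using hne 1 2 (by decide)),
      if_neg (by decide), if_neg (by decide), if_neg (by decide), if_neg (by decide),
      if_neg (by decide), if_neg (by decide), if_neg (by decide), if_pos (by decide)] at h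
    linear_combination -h
  · have h := permWeight_contraction he (Equiv.swap 0 2 * Equiv.swap 1 3) (p := 0) (q := 2)
      (by decide)
    rw [sum_twoRowTensor_update_zero_two, e2, Finset.sum_insert (by decide),
      Finset.sum_insert (by decide), Finset.sum_singleton,
      hw (Equiv.swap 0 2 * Equiv.swap 1 3 * Equiv.swap 2 0),
      hw (Equiv.swap 0 2 * Equiv.swap 1 3 * Equiv.swap 2 1),
      hw (Equiv.swap 0 2 * Equiv.swap 1 3 * Equiv.swap 2 3),
      if_neg (by decide), if_neg (by decide), if_neg (by decide), if_neg (by decide),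
      if_neg (by decide), if_pos (by decide)] at h
    have hE : Function.Injective ![e 1, e 2, e 3] := by
      intro p q
      have h1 := hne 1 2 (by decide)
      have h2 := hne 1 3 (by decide)
      have h3 := hne 2 3 (by decide)
      fin_cases p <;> fin_cases q <;> simp [h1, h1.symm, h2, h2.symm, h3, h3.symm]
    have hr := rowTensor_self_three hE
    -- The plain indices left after contraction are a cyclic rearrangement of the conjugate ones,
    -- which a single-row moment does not see.
    have hv : ![(e ∘ (Equiv.swap 0 2 * Equiv.swap 1 3 : Equiv.Perm (Fin 4))) 0,
        (e ∘ (Equiv.swap 0 2 * Equiv.swap 1 3 : Equiv.Perm (Fin 4))) 1,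
        (e ∘ (Equiv.swap 0 2 * Equiv.swap 1 3 : Equiv.Perm (Fin 4))) 3] =
        ![e 1, e 2, e 3] ∘ (Equiv.swap 0 1 * Equiv.swap 1 2 : Equiv.Perm (Fin 3)) := by
      ext p
      fin_cases p
      · exact congrArg (fun x => (e x).val) (by decide : _ = (2 : Fin 4))
      · exact congrArg (fun x => (e x).val) (by decide : _ = (3 : Fin 4))
      · exact congrArg (fun x => (e x).val) (by decide : _ = (1 : Fin 4))
    rw [hv, rowTensor_comp_right] at h
    rw [h] at hr
    linear_combination hr

/-- The coefficient in `twoRowTensor` of the permutations that preserve the two blocks. -/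
noncomputable def blockCoeff (x : ℝ) : ℝ :=
  1 / (x + 1) ^ 2 + 2 / (x * (x + 1) ^ 2 * (x + 2) * (x + 3))

/-- The coefficient in `twoRowTensor` of the permutations that exchange the two blocks. -/
noncomputable def crossCoeff (x : ℝ) : ℝ := 1 / (x * (x + 1) * (x + 3))

/-- The coefficient in `twoRowTensor` of the permutations that mix the two blocks. -/
noncomputable def mixedCoeff (x : ℝ) : ℝ := -(1 / (x * (x + 1) * (x + 2) * (x + 3)))

theorem permWeight_values {e : Fin 4 → Fin d} (he : Function.Injective e) :
    permWeight e 1 = blockCoeff d ∧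
      permWeight e (Equiv.swap 0 2 * Equiv.swap 1 3) = crossCoeff d ∧
      permWeight e (Equiv.swap 0 2) = mixedCoeff d := by
  obtain ⟨h1, h2, h3⟩ := permWeight_linear_system he
  generalize permWeight e 1 = a at *
  generalize permWeight e (Equiv.swap 0 2 * Equiv.swap 1 3) = b at *
  generalize permWeight e (Equiv.swap 0 2) = c at *
  have d0 : (d : ℂ) ≠ 0 := Nat.cast_ne_zero.mpr (e 0).pos.ne'
  have d1 : (d : ℂ) + 1 ≠ 0 := by exact_mod_cast d.succ_ne_zero
  have d2 : (d : ℂ) + 2 ≠ 0 := by exact_mod_cast (d + 1).succ_ne_zero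
  have d3 : (d : ℂ) + 3 ≠ 0 := by exact_mod_cast (d + 2).succ_ne_zero
  have hb : b = -((d + 2) * c) := by linear_combination h2
  have hc : c = -(1 / (d * (d + 1) * (d + 2) * (d + 3))) := by
    subst hb
    field_simp
    linear_combination -h3
  have ha : a = 1 / ((d : ℂ) + 1) ^ 2 - 2 * c / (d + 1) := by
    field_simp
    linear_combination h1
  unfold blockCoeff crossCoeff mixedCoeff
  push_cast
  refine ⟨?_, ?_, hc⟩
  · rw [ha, hc]; field_simp
    ring
  · rw [hb, hc]; field_simp

/-- Summing index matches over the block or exchanging permutations factors into two pairings. `R`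
counts matches by mixed permutations, crudely bounded by the order 24 of the group. -/
theorem twoRowTensor_eq (hd : 4 ≤ d) (k l m n k' l' m' n' : Fin d) :
    ∃ R : ℂ, ‖R‖ ≤ 24 ∧ twoRowTensor ![k, m, k', m'] ![l, n, l', n'] =
      blockCoeff d * (pairing k m l n * pairing k' m' l' n') +
        crossCoeff d * (pairing k m l' n' * pairing k' m' l n) + mixedCoeff d * R := by
  have he := Fin.castLE_injective hd
  obtain ⟨ha, hb, hc⟩ := permWeight_values he
  let D : Equiv.Perm (Fin 4) → ℂ := fun σ =>
    if ![l, n, l', n'] = ![k, m, k', m'] ∘ σ then 1 else 0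
  let J : Fin d → Fin d → Fin d → Fin d → ℂ := fun a b x y => if a = x ∧ b = y then 1 else 0
  have hp : ∀ a b x y : Fin d, pairing a b x y = J a b x y + J b a x y := fun _ _ _ _ => rfl
  have hD : ∀ (σ : Equiv.Perm (Fin 4)) (x y z t : Fin 4), (σ 0 = x ∧ σ 1 = y ∧ σ 2 = z ∧ σ 3 = t) →
      D σ = J (![k, m, k', m'] x) (![k, m, k', m'] y) l n *
        J (![k, m, k', m'] z) (![k, m, k', m'] t) l' n' := by
    rintro σ x y z t ⟨rfl, rfl, rfl, rfl⟩
    have h : ![l, n, l', n'] = ![k, m, k', m'] ∘ σ ↔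
        (![k, m, k', m'] (σ 0) = l ∧ ![k, m, k', m'] (σ 1) = n) ∧
          (![k, m, k', m'] (σ 2) = l' ∧ ![k, m, k', m'] (σ 3) = n') := by
      rw [funext_iff, Fin.forall_fin_succ, Fin.forall_fin_succ, Fin.forall_fin_two, and_assoc]
      exact and_congr eq_comm (and_congr eq_comm (and_congr eq_comm eq_comm))
    simp only [D, J, h, ite_and, mul_ite, mul_one, mul_zero]
    split_ifs <;> rfl
  have hblock : ∑ σ ∈ blockPerms, D σ = pairing k m l n * pairing k' m' l' n' := by
    rw [blockPerms, Finset.sum_insert (by decide), Finset.sum_insert (by decide),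
      Finset.sum_pair (by decide)]
    rw [hD 1 0 1 2 3 (by decide), hD (Equiv.swap 0 1) 1 0 2 3 (by decide),
      hD (Equiv.swap 2 3) 0 1 3 2 (by decide),
      hD (Equiv.swap 0 1 * Equiv.swap 2 3) 1 0 3 2 (by decide)]
    simp only [hp, Matrix.cons_val]
    ring
  have hcross : ∑ σ ∈ crossPerms, D σ = pairing k m l' n' * pairing k' m' l n := by
    rw [crossPerms, Finset.sum_insert (by decide), Finset.sum_insert (by decide),
      Finset.sum_pair (by decide)]
    rw [hD (Equiv.swap 0 2 * Equiv.swap 1 3) 2 3 0 1 (by decide),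
      hD (Equiv.swap 0 2 * Equiv.swap 1 3 * Equiv.swap 0 1) 3 2 0 1 (by decide),
      hD (Equiv.swap 0 2 * Equiv.swap 1 3 * Equiv.swap 2 3) 2 3 1 0 (by decide),
      hD (Equiv.swap 0 2 * Equiv.swap 1 3 * (Equiv.swap 0 1 * Equiv.swap 2 3)) 3 2 1 0 (by decide)]
    simp only [hp, Matrix.cons_val]
    ring
  have hsub : blockPerms ⊆ univ := Finset.subset_univ _
  have hsub' : crossPerms ⊆ univ \ blockPerms := by decide
  refine ⟨∑ σ ∈ (univ \ blockPerms) \ crossPerms, D σ, ?_, ?_⟩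
  · refine (norm_sum_le_of_le _ (n := fun _ => (1 : ℝ)) fun σ _ => ?_).trans ?_
    · simp only [D]; split_ifs <;> simp
    · rw [Finset.sum_const, nsmul_eq_mul, mul_one]
      have : #((univ \ blockPerms) \ crossPerms) ≤ 24 := by decide
      exact_mod_cast this
  · rw [isUnitaryInvariant_twoRowTensor.eq_sum_perm he, ← hblock, ← hcross,
      ← Finset.sum_sdiff hsub, ← Finset.sum_sdiff hsub', Finset.mul_sum, Finset.mul_sum,
      Finset.mul_sum, ← ha, ← hb, ← hc, add_comm, add_comm (∑ σ ∈ _ \ _, _), ← add_assoc]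
    have hw : ∀ σ : Equiv.Perm (Fin 4), twoRowTensor (Fin.castLE hd) (Fin.castLE hd ∘ σ) = _ :=
      permWeight_eq_ite he
    simp only [hw, D, mul_ite, mul_one, mul_zero]
    refine congrArg₂ _ (congrArg₂ _ ?_ ?_) ?_
    · exact Finset.sum_congr rfl fun σ hσ => by rw [if_pos hσ]
    · refine Finset.sum_congr rfl fun σ hσ => ?_
      rw [if_neg (Finset.mem_sdiff.mp (hsub' hσ)).2, if_pos hσ]
    · refine Finset.sum_congr rfl fun σ hσ => ?_
      rw [Finset.mem_sdiff, Finset.mem_sdiff] at hσ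
      rw [if_neg hσ.1.2, if_neg hσ.2]

/-! ### The covariance of `γ` and its asymptotics. -/

/-- The part `∑ⱼ conj ψⱼₖ ψⱼₗ conj ψⱼₘ ψⱼₙ` of `γ(k,l,m,n)`. -/
noncomputable def quarticSum (k l m n : Fin d) (Ψ : U d) : ℂ :=
  ∑ j : Fin d, star (Ψ.1 j k) * Ψ.1 j l * star (Ψ.1 j m) * Ψ.1 j n

theorem gamma_eq (k l m n : Fin d) (Ψ : U d) :
    gamma k l m n Ψ = quarticSum k l m n Ψ - pairing k m l n / d := by
  simp only [gamma, quarticSum, pairing, add_div, ite_div, zero_div,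
    eq_comm (a := m) (b := l), and_comm (a := l = m)]
  ring

theorem continuous_quarticSum (k l m n : Fin d) : Continuous (quarticSum k l m n) :=
  continuous_finsetSum _ fun j _ => (((continuous_entry j k).star.mul (continuous_entry j l)).mul
    (continuous_entry j m).star).mul (continuous_entry j n)

theorem norm_quarticSum_le (k l m n : Fin d) (Ψ : U d) : ‖quarticSum k l m n Ψ‖ ≤ d := by
  refine (norm_sum_le_of_le _ (n := fun _ => (1 : ℝ)) fun j _ => ?_).trans (by simp)
  have h := fun x => entry_norm_bound_of_unitary Ψ.2 j x
  simp only [norm_mul, norm_star]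
  exact mul_le_one₀ (mul_le_one₀ (mul_le_one₀ (h k) (norm_nonneg _) (h l)) (norm_nonneg _) (h m))
    (norm_nonneg _) (h n)

theorem integral_quarticSum (k l m n : Fin d) :
    ∫ Ψ, quarticSum k l m n Ψ ∂(haarU d) = rowTensor ![k, m] ![l, n] := by
  unfold quarticSum rowTensor moment
  rw [integral_finsetSum]
  · simp [Fin.prod_univ_two, mul_assoc]
  · exact fun j _ => integrable_haarU ((((continuous_entry j k).star.mul
      (continuous_entry j l)).mul (continuous_entry j m).star).mul (continuous_entry j n))

theorem integral_quarticSum_mul (k l m n k' l' m' n' : Fin d) :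
    ∫ Ψ, quarticSum k l m n Ψ * quarticSum k' l' m' n' Ψ ∂(haarU d) =
      twoRowTensor ![k, m, k', m'] ![l, n, l', n'] := by
  have hi : ∀ j j', Integrable (fun Ψ : U d => ∏ p : Fin 4,
      star (Ψ.1 (if p < 2 then j else j') (![k, m, k', m'] p)) *
        Ψ.1 (if p < 2 then j else j') (![l, n, l', n'] p)) (haarU d) := fun j j' =>
    integrable_haarU (continuous_prod_entries (fun p => if p < 2 then j else j') _ _)
  unfold quarticSum twoRowTensor moment
  rw [Finset.sum_congr rfl fun j _ => (integral_finsetSum _ fun j' _ => hi j j').symm,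
    ← integral_finsetSum]
  · congr 1
    ext Ψ
    rw [Finset.sum_mul_sum]
    refine Finset.sum_congr rfl fun j _ => Finset.sum_congr rfl fun j' _ => ?_
    simp only [Fin.prod_univ_four, Matrix.cons_val, show (0 : Fin 4) < 2 by decide,
      show (1 : Fin 4) < 2 by decide, show ¬ (2 : Fin 4) < 2 by decide,
      show ¬ (3 : Fin 4) < 2 by decide, if_true, if_false]
    ring
  · exact fun j _ => integrable_finsetSum _ fun j' _ => hi j j'

theorem integral_gamma_mul (k l m n k' l' m' n' : Fin d) :
    ∫ Ψ, gamma k l m n Ψ * gamma k' l' m' n' Ψ ∂(haarU d) =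
      twoRowTensor ![k, m, k', m'] ![l, n, l', n'] -
        pairing k' m' l' n' / d * rowTensor ![k, m] ![l, n] -
        pairing k m l n / d * rowTensor ![k', m'] ![l', n'] +
        pairing k m l n / d * (pairing k' m' l' n' / d) := by
  have hi := integrable_haarU (continuous_quarticSum k l m n)
  have hi' := integrable_haarU (continuous_quarticSum k' l' m' n')
  have hii : Integrable (fun Ψ => quarticSum k l m n Ψ * quarticSum k' l' m' n' Ψ) (haarU d) :=
    integrable_haarU ((continuous_quarticSum k l m n).mul (continuous_quarticSum k' l' m' n'))
  have h : ∀ Ψ, gamma k l m n Ψ * gamma k' l' m' n' Ψ =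
      quarticSum k l m n Ψ * quarticSum k' l' m' n' Ψ -
        pairing k' m' l' n' / d * quarticSum k l m n Ψ -
        pairing k m l n / d * quarticSum k' l' m' n' Ψ +
        pairing k m l n / d * (pairing k' m' l' n' / d) := fun Ψ => by
    simp only [gamma_eq]
    ring
  simp only [h]
  have hi1 := hii.sub (hi.const_mul (pairing k' m' l' n' / d))
  rw [integral_add, integral_sub, integral_sub hii (hi.const_mul _), integral_const_mul,
    integral_const_mul, integral_quarticSum_mul, integral_quarticSum, integral_quarticSum]
  · simp
  · exact hi1
  · exact hi'.const_mul _
  · exact hi1.sub (hi'.const_mul _)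
  · exact integrable_const _

theorem norm_pairing_le (k m l n : Fin d) : ‖pairing k m l n‖ ≤ 2 := by
  unfold pairing
  split_ifs <;> norm_num

theorem norm_pairing_mul_le (k m l n k' m' l' n' : Fin d) :
    ‖pairing k m l n * pairing k' m' l' n'‖ ≤ 4 := by
  rw [norm_mul]
  calc _ ≤ (2 : ℝ) * 2 := mul_le_mul (norm_pairing_le _ _ _ _) (norm_pairing_le _ _ _ _)
        (norm_nonneg _) (by norm_num)
    _ = 4 := by norm_num

theorem norm_gamma_le (k l m n : Fin d) (Ψ : U d) : ‖gamma k l m n Ψ‖ ≤ d + 2 := by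
  rw [gamma_eq]
  refine (norm_sub_le _ _).trans (add_le_add (norm_quarticSum_le k l m n Ψ) ?_)
  rw [norm_div, Complex.norm_natCast]
  have hd : (1 : ℝ) ≤ d := by exact_mod_cast k.pos
  exact (div_le_self (norm_nonneg _) hd).trans (norm_pairing_le _ _ _ _)

theorem norm_integral_gamma_mul_le (k l m n k' l' m' n' : Fin d) :
    ‖∫ Ψ, gamma k l m n Ψ * gamma k' l' m' n' Ψ ∂(haarU d)‖ ≤ ((d : ℝ) + 2) * (d + 2) := by
  have h := norm_integral_le_of_norm_le_const (μ := haarU d) (C := ((d : ℝ) + 2) * (d + 2))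
    (f := fun Ψ => gamma k l m n Ψ * gamma k' l' m' n' Ψ) (.of_forall fun Ψ => by
      rw [norm_mul]
      exact mul_le_mul (norm_gamma_le _ _ _ _ _) (norm_gamma_le _ _ _ _ _) (norm_nonneg _)
        (by positivity))
  simpa using h

/-- This is the total coefficient of the product of the two separate pairings in `E[γγ']`:
`2/(x(x+1))` comes from the cross terms of the centering, `1/x²` from its square. Orders two and
three cancel. -/
theorem abs_blockCoeff_sub_le {x : ℝ} (hx : 1 ≤ x) :
    |blockCoeff x - 2 / (x * (x + 1)) + 1 / x ^ 2| ≤ 3 / x ^ 4 := by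
  have hx0 : 0 < x := by linarith
  have h : blockCoeff x - 2 / (x * (x + 1)) + 1 / x ^ 2 =
      1 / (x ^ 2 * (x + 1) ^ 2) + 2 / (x * (x + 1) ^ 2 * (x + 2) * (x + 3)) := by
    unfold blockCoeff
    field_simp
    ring
  rw [h, abs_of_nonneg (by positivity), show (3 : ℝ) / x ^ 4 = 1 / x ^ 4 + 2 / x ^ 4 by ring]
  refine add_le_add (div_le_div_of_nonneg_left (by positivity) (by positivity) ?_)
    (div_le_div_of_nonneg_left (by positivity) (by positivity) ?_)
  · calc x ^ 4 = x ^ 2 * x ^ 2 := by ring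
      _ ≤ x ^ 2 * (x + 1) ^ 2 := by gcongr; linarith
  · calc x ^ 4 = x * (x * 1) * x * x := by ring
      _ ≤ x * (x + 1) ^ 2 * (x + 2) * (x + 3) := by
        rw [sq]; gcongr <;> linarith

theorem abs_crossCoeff_sub_le {x : ℝ} (hx : 1 ≤ x) :
    |crossCoeff x - 1 / x ^ 3| ≤ 4 / x ^ 4 := by
  have hx0 : 0 < x := by linarith
  have h : crossCoeff x - 1 / x ^ 3 = -((4 * x + 3) / (x ^ 3 * (x + 1) * (x + 3))) := by
    unfold crossCoeff
    field_simp
    ring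
  rw [h, abs_neg, abs_of_nonneg (by positivity), div_le_div_iff₀ (by positivity) (by positivity)]
  have : 0 ≤ x ^ 3 * (13 * x + 12) := by positivity
  linarith

theorem abs_mixedCoeff_le {x : ℝ} (hx : 1 ≤ x) : |mixedCoeff x| ≤ 1 / x ^ 4 := by
  have hx0 : 0 < x := by linarith
  rw [mixedCoeff, abs_neg, abs_of_nonneg (by positivity)]
  refine div_le_div_of_nonneg_left (by positivity) (by positivity) ?_
  calc x ^ 4 = x * x * x * x := by ring
    _ ≤ x * (x + 1) * (x + 2) * (x + 3) := by gcongr <;> linarith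

/-- For `d ≥ 4` the errors add up to `52/d⁴`. For `d ≤ 3` the trivial bound `5 · 5 + 4 = 29` fixes
the constant `2349 = 29 · 3⁴`. -/
theorem norm_integral_gamma_mul_sub_le (k l m n k' l' m' n' : Fin d) :
    ‖(∫ Ψ, gamma k l m n Ψ * gamma k' l' m' n' Ψ ∂(haarU d)) -
      pairing k m l' n' * pairing k' m' l n / (d : ℂ) ^ 3‖ ≤ 2349 / (d : ℝ) ^ 4 := by
  have hd1 : (1 : ℝ) ≤ d := by exact_mod_cast k.pos
  have hd0 : (d : ℂ) ≠ 0 := Nat.cast_ne_zero.mpr k.pos.ne'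
  have hd0' : (d : ℂ) + 1 ≠ 0 := Nat.cast_add_one_ne_zero d
  have hB := norm_pairing_mul_le k m l' n' k' m' l n
  by_cases hd : 4 ≤ d
  · obtain ⟨R, hR, hT⟩ := twoRowTensor_eq hd k l m n k' l' m' n'
    have hA := norm_pairing_mul_le k m l n k' m' l' n'
    have h2 : 2 ≤ d := by omega
    have key : (∫ Ψ, gamma k l m n Ψ * gamma k' l' m' n' Ψ ∂(haarU d)) -
        pairing k m l' n' * pairing k' m' l n / (d : ℂ) ^ 3 =
        ((blockCoeff d - 2 / ((d : ℝ) * (d + 1)) + 1 / (d : ℝ) ^ 2 : ℝ) : ℂ) *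
          (pairing k m l n * pairing k' m' l' n') +
        ((crossCoeff d - 1 / (d : ℝ) ^ 3 : ℝ) : ℂ) * (pairing k m l' n' * pairing k' m' l n) +
        (mixedCoeff d : ℂ) * R := by
      rw [integral_gamma_mul, hT, rowTensor_two h2, rowTensor_two h2]
      push_cast
      field_simp
      ring
    rw [key]
    calc _ ≤ 3 / (d : ℝ) ^ 4 * 4 + 4 / (d : ℝ) ^ 4 * 4 + 1 / (d : ℝ) ^ 4 * 24 := by
          refine norm_add₃_le.trans (add_le_add (add_le_add ?_ ?_) ?_) <;>
            rw [norm_mul, Complex.norm_real, Real.norm_eq_abs]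
          · exact mul_le_mul (abs_blockCoeff_sub_le hd1) hA (norm_nonneg _) (by positivity)
          · exact mul_le_mul (abs_crossCoeff_sub_le hd1) hB (norm_nonneg _) (by positivity)
          · exact mul_le_mul (abs_mixedCoeff_le hd1) hR (norm_nonneg _) (by positivity)
      _ = 52 / (d : ℝ) ^ 4 := by ring
      _ ≤ 2349 / (d : ℝ) ^ 4 := by gcongr; norm_num
  · have hd3 : (d : ℝ) ≤ 3 := by exact_mod_cast (by omega : d ≤ 3)
    have h1 : ‖pairing k m l' n' * pairing k' m' l n / (d : ℂ) ^ 3‖ ≤ 4 := by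
      rw [norm_div, norm_pow, Complex.norm_natCast]
      exact (div_le_self (norm_nonneg _) (one_le_pow₀ hd1)).trans hB
    calc _ ≤ ((d : ℝ) + 2) * (d + 2) + 4 :=
          (norm_sub_le _ _).trans (add_le_add (norm_integral_gamma_mul_le _ _ _ _ _ _ _ _) h1)
      _ ≤ (3 + 2) * (3 + 2) + 4 := by gcongr
      _ = 2349 / 3 ^ 4 := by norm_num
      _ ≤ 2349 / (d : ℝ) ^ 4 := by gcongr

/-! ### Symmetries of `γ` and the dichotomy. -/

theorem star_gamma (k l m n : Fin d) (Ψ : U d) : star (gamma k l m n Ψ) = gamma l k n m Ψ := by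
  have h1 : ∀ p : Prop, [Decidable p] → star (if p then 1 / (d : ℂ) else 0) =
      if p then 1 / (d : ℂ) else 0 := fun p _ => by split_ifs <;> simp
  unfold gamma
  rw [star_sub, star_sub, h1, h1, star_sum]
  simp only [star_mul', star_star, eq_comm (a := l), eq_comm (a := n), and_comm (a := k = n)]
  congr 2
  exact Finset.sum_congr rfl fun j _ => by ring

theorem gamma_swap_left (k l m n : Fin d) : gamma m l k n = gamma k l m n := by
  ext Ψ
  simp only [gamma_eq, quarticSum, pairing, add_comm (if m = l ∧ k = n then (1 : ℂ) else 0)]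
  congr 1
  exact Finset.sum_congr rfl fun j _ => by ring

theorem gamma_swap_right (k l m n : Fin d) : gamma k n m l = gamma k l m n := by
  ext Ψ
  simp only [gamma_eq, quarticSum, pairing, and_comm (b := k = n), and_comm (b := k = l),
    add_comm (if k = n ∧ m = l then (1 : ℂ) else 0)]
  congr 1
  exact Finset.sum_congr rfl fun j _ => by ring

theorem pairing_ne_zero_iff (k m l n : Fin d) :
    pairing k m l n ≠ 0 ↔ (k = l ∧ m = n) ∨ (m = l ∧ k = n) := by
  unfold pairing
  split_ifs <;> norm_num <;> tauto

/-- Nonzero pairings say `{l', n'} = {k, m}` and `{k', m'} = {l, n}` with multiplicity; the four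
orderings are absorbed by the symmetries of `γ`. -/
theorem gamma_eq_star_of_pairing_ne_zero {k l m n k' l' m' n' : Fin d}
    (h : pairing k m l' n' * pairing k' m' l n ≠ 0) (Ψ : U d) :
    gamma k' l' m' n' Ψ = star (gamma k l m n Ψ) := by
  rw [star_gamma]
  rw [mul_ne_zero_iff, pairing_ne_zero_iff, pairing_ne_zero_iff] at h
  obtain ⟨⟨rfl, rfl⟩ | ⟨rfl, rfl⟩, ⟨rfl, rfl⟩ | ⟨rfl, rfl⟩⟩ := h
  · rfl
  · rw [gamma_swap_left]
  · rw [gamma_swap_right]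
  · rw [gamma_swap_left, gamma_swap_right]

/-- The limiting variance of `γ(k,l,m,n)`, rescaled by `d³`. -/
noncomputable def limitVariance (k l m n : ℕ) : ℝ :=
  (1 + if k = m then 1 else 0) * (1 + if l = n then 1 else 0)

theorem pairing_self_mul (k l m n : Fin d) :
    pairing k m k m * pairing l n l n = (limitVariance k l m n : ℂ) := by
  simp only [pairing, limitVariance, Fin.val_inj, and_self, if_true, eq_comm (a := m),
    eq_comm (a := n)]
  split_ifs <;> simp

end RandomUnitary

theorem corollary3p10 :
    ∃ σsq : ℕ → ℕ → ℕ → ℕ → ℝ,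
      (∀ k l m n : ℕ, 0 < σsq k l m n) ∧
      (∀ k l m n : ℕ, k ≠ l → k ≠ m → k ≠ n → l ≠ m → l ≠ n → m ≠ n → σsq k l m n = 1) ∧
      ∃ C : ℝ, ∀ (d : ℕ) (k l m n k' l' m' n' : Fin d),
        ((∀ Ψ : RandomUnitary.U d, RandomUnitary.gamma k' l' m' n' Ψ = star (RandomUnitary.gamma k l m n Ψ)) →
          ‖(∫ Ψ, RandomUnitary.gamma k l m n Ψ * RandomUnitary.gamma k' l' m' n' Ψ ∂(RandomUnitary.haarU d))
              - ((σsq k l m n / (d : ℝ) ^ 3 : ℝ) : ℂ)‖ ≤ C / (d : ℝ) ^ 4) ∧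
        ((¬ ∀ Ψ : RandomUnitary.U d, RandomUnitary.gamma k' l' m' n' Ψ = star (RandomUnitary.gamma k l m n Ψ)) →
          ‖∫ Ψ, RandomUnitary.gamma k l m n Ψ * RandomUnitary.gamma k' l' m' n' Ψ ∂(RandomUnitary.haarU d)‖ ≤ C / (d : ℝ) ^ 4) := by
  refine ⟨RandomUnitary.limitVariance, fun k l m n => ?_, fun k l m n _ hkm _ _ hln _ => ?_, 2349,
    fun d k l m n k' l' m' n' => ⟨fun h => ?_, fun h => ?_⟩⟩
  · unfold RandomUnitary.limitVariance
    split_ifs <;> norm_num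
  · simp [RandomUnitary.limitVariance, hkm, hln]
  -- Equality as functions lets the integrand use the indices `l, k, n, m` of the conjugate, so
  -- nothing need be known about the primed indices.
  · have hb := RandomUnitary.norm_integral_gamma_mul_sub_le k l m n l k n m
    rw [RandomUnitary.pairing_self_mul] at hb
    simp only [h, RandomUnitary.star_gamma]
    push_cast
    exact hb
  -- By contraposition the pairing product vanishes, and the `d⁻³` term with it.
  · have hb := RandomUnitary.norm_integral_gamma_mul_sub_le k l m n k' l' m' n'
    rwa [not_not.mp (mt RandomUnitary.gamma_eq_star_of_pairing_ne_zero h), zero_div,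
      sub_zero] at hb
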